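/- Conventions. $\omega_1,\omega_2$ are the first and second uncountable ordinals, $[X]^{\omega}$ is the set of countably infinite subsets of $X$, and $[X]^{<\omega}$ is the set of finite subsets of $X$. **Morass.** A simplified $(\omega_1,1)$-morass $\mathfrak M$ consists of ordinals $\theta_\alpha<\omega_1$ $(\alpha<\omega_1)$, $\theta_{\omega_1}=\omega_2$, and sets $\mathcal F_{\alpha,\beta}$ of order-preserving embeddings $\theta_\alpha\to\theta_\beta$ $(\alpha<\beta\le\omega_1)$ such that: 1. for every $\alpha<\omega_1$ there are $\gamma_\alpha,\eta_\alpha$ with $\theta_\alpha=\gamma_\alpha+\eta_\alpha$, $\theta_{\alpha+1}=\theta_\alpha+\eta_\alpha$ and $\mathcal F_{\alpha,\alpha+1}=\{\mathrm{id}_{\theta_\alpha},s_\alpha\}$, where $s_\alpha$ is the identity on $\gamma_\alpha$ and $s_\alpha(\gamma_\alpha+\xi)=\theta_\alpha+\xi$ for $\xi<\eta_\alpha$; 2. $\mathcal F_{\alpha,\gamma}=\{g\circ f: f\in\mathcal F_{\alpha,\beta},\ g\in\mathcal F_{\beta,\gamma}\}$ for $\alpha<\beta<\gamma\le\omega_1$;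 3. if $\gamma\le\omega_1$ is a limit, $\alpha<\gamma$ and $f,g\in\mathcal F_{\alpha,\gamma}$, there are $\beta$ with $\alpha<\beta<\gamma$, $f',g'\in\mathcal F_{\alpha,\beta}$ and $h\in\mathcal F_{\beta,\gamma}$ with $f=h\circ f'$ and $g=h\circ g'$; 4. $\theta_\beta=\bigcup\{f[\theta_\alpha]:f\in\mathcal F_{\alpha,\beta}\}$ for $\alpha<\beta\le\omega_1$. For $\alpha<\omega_1$ and $\xi<\omega_2$, let $\pi_\alpha(\xi)$ be the unique $\eta<\theta_\alpha$ with $f(\eta)=\xi$ for some $f\in\mathcal F_{\alpha,\omega_1}$. Write $\xi\preceq\eta$ iff $\pi_\alpha(\xi)\le\pi_\alpha(\eta)$ for all $\alpha<\omega_1$, and $\xi\preceq_\alpha\eta$ iff $\xi\preceq\eta$ and $\pi_\alpha(\xi)=\pi_\alpha(\eta)$. The morass is *stationary* if $\{f[\theta_\alpha]:\alpha<\omega_1,\ f\in\mathcal F_{\alpha,\omega_1}\}$ meets every closed unbounded subset of $[\omega_2]^{\omega}$. It satisfies the *$\aleph_2$-antichain condition* if every $X\subseteq(\omega_2)^{\omega}$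 of size $\aleph_2$ contains distinct $s,t$ with $s(n)\preceq t(n)$ for all $n$. $\mathcal F=\mathcal F(\mathfrak M)$ is the set of all functions $f$ from a countable subset of $\omega_2$ to $\omega_1$ such that (i) if $\xi,\eta\in\mathrm{dom} f$, $f(\eta)=\alpha$ and $\xi\preceq_\alpha\eta$, then $f(\xi)=\alpha$; and (ii) for every $\alpha\in\mathrm{ran} f$ there is $\zeta<\omega_2$ with $\xi\preceq\zeta$ for all $\xi\in f^{-1}\{\alpha\}$. **The structure $\mathcal C$.** For $u\in[\omega_2]^{\omega}$ let $\mathcal F_u=\{f\in\mathcal F:\mathrm{dom} f=u\}$ and let $\mathcal G_u=[\mathcal F_u]^{<\omega}$, a Boolean group under symmetric difference $\Delta$; the empty sets of the different $\mathcal G_u$ are replaced by distinct objects $\emptyset_u$. Index the members of each $\mathcal F_u$ injectively by elements of $2^{\omega}$, the index of $f$ being $x_f$. For $u\subseteq v$ let $\pi_{u,v}:\mathcal G_v\to\mathcal G_u$ be the homomorphism with $\pi_{u,v}(\{f\})=\{f\restriction u\}$. The base set of $\mathcal C$ is the disjoint union of $\omega_2$ and all $\mathcal G_u$, $u\in[\omega_2]^{\omega}$;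 for $a\in\mathcal G_u$ put $u(a)=u$. The relations of $\mathcal C$, all binary, are: - $\le$, the usual ordering of $\omega_2$; - $E(\alpha,a)$ iff $\alpha<\omega_2$, $a$ belongs to a layer, and $\alpha\in u(a)$; - $R_{n,i}(a,b)$ $(n<\omega,\ i\in\{0,1\})$ iff $a,b$ belong to the same $\mathcal G_u$, $a\Delta b=\{f\}$ is a singleton, and $x_f(n)=i$; - $S(a,b)$ iff $a,b$ belong to layers, $u(a)\subseteq u(b)$ and $\pi_{u(a),u(b)}(b)=a$. **Partial isomorphism.** Structures $\mathcal A,\mathcal B$ in the same vocabulary are *$(\aleph_1,\aleph_1)$-partially isomorphic* if there is a nonempty set $\mathcal I$ of isomorphisms between countable substructures of $\mathcal A$ and of $\mathcal B$ such that (a) for all $p\in\mathcal I$ and countable $A_0\subseteq\mathcal A$, $B_0\subseteq\mathcal B$ there is $q\in\mathcal I$ extending $p$ with $A_0\subseteq\mathrm{dom}\, q$ and $B_0\subseteq\mathrm{ran}\, q$; and (b) every increasing chain in $\mathcal I$ of countable length has an upper bound in $\mathcal I$. **Lemma.** Assume CH. Let $\mathfrak M$ be a simplified $(\omega_1,1)$-morass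 that is stationary and satisfies the $\aleph_2$-antichain condition, let $\mathcal C$ be built from $\mathcal F(\mathfrak M)$ as above (with any such indexings), and let $f^*\in\mathcal F_\omega$. Let $\mathcal A$ and $\mathcal B$ be the expansions of $\mathcal C$ by a constant symbol $c$ interpreted as $\emptyset_\omega$ and as $\{f^*\}$, respectively. Then $\mathcal A$ and $\mathcal B$ are not $(\aleph_1,\aleph_1)$-partially isomorphic. -/

import Mathlib

open Set Ordinal Cardinal
open scoped FirstOrder symmDiff

/-! ### Partially isomorphic structures -/

namespace PartialIso

universe u v w

variable (L : FirstOrder.Language.{u, v}) (A B : Type w) [L.Structure A] [L.Structure B]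

/-- A `κ`-back-and-forth set: a nonempty set of isomorphisms between substructures of `A` and `B`
of size `< κ` such that every member can be extended inside the set so that its domain and range
contain any prescribed subsets of `A` and `B` of size `< κ`. -/
def IsBackAndForth (κ : Cardinal.{w}) (I : Set (A ≃ₚ[L] B)) : Prop :=
  I.Nonempty ∧ (∀ p ∈ I, #p.dom < κ) ∧
    ∀ p ∈ I, ∀ (A₀ : Set A) (B₀ : Set B), #A₀ < κ → #B₀ < κ →
      ∃ q ∈ I, p ≤ q ∧ A₀ ⊆ q.dom ∧ B₀ ⊆ q.cod

/-- Every increasing chain of (ordinal) length `< lam` in `I` has an upper bound in `I`. -/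
def IsChainClosed (lam : Cardinal.{w}) (I : Set (A ≃ₚ[L] B)) : Prop :=
  ∀ δ : Ordinal.{w}, δ < lam.ord → ∀ p : Iio δ → (A ≃ₚ[L] B), Monotone p → (∀ i, p i ∈ I) →
    ∃ q ∈ I, ∀ i, p i ≤ q

/-- `A` and `B` are `(κ, lam)`-partially isomorphic. -/
def PartiallyIsomorphic (κ lam : Cardinal.{w}) : Prop :=
  ∃ I : Set (A ≃ₚ[L] B), IsBackAndForth L A B κ I ∧ IsChainClosed L A B lam I

end PartialIso

/-! ### Stationary sets of countable sets -/

/-- `[X]^ω`: the countably infinite subsets of `X`. -/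
abbrev CtblInf (X : Type*) : Type _ := {u : Set X // u.Countable ∧ u.Infinite}

/-- Closed unbounded subsets of `[X]^ω`. -/
def IsClubCtbl {X : Type*} (C : Set (Set X)) : Prop :=
  (∀ u ∈ C, u.Countable ∧ u.Infinite) ∧
  (∀ s : ℕ → Set X, Monotone s → (∀ n, s n ∈ C) → (⋃ n, s n) ∈ C) ∧
  ∀ u : Set X, u.Countable → u.Infinite → ∃ v ∈ C, u ⊆ v

/-- `S` meets every closed unbounded subset of `[X]^ω`. -/
def IsStationaryCtbl {X : Type*} (S : Set (Set X)) : Prop :=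
  ∀ C : Set (Set X), IsClubCtbl C → (S ∩ C).Nonempty

/-! ### Simplified morasses -/

/-- The ordinal `ω₁`, as the set of smaller ordinals. -/
abbrev Omega1 : Type 1 := Iio (ω_ 1 : Ordinal.{0})

/-- The ordinal `ω₂`, as the set of smaller ordinals. -/
abbrev Omega2 : Type 1 := Iio (ω_ 2 : Ordinal.{0})

/-- A simplified `(ω₁, 1)`-morass. Only the values `θ α` for `α ≤ ω₁` and `F α β` for
`α < β ≤ ω₁` matter. -/
structure SimplifiedMorass where
  θ : Ordinal.{0} → Ordinal.{0}
  F : (α β : Ordinal.{0}) → Set (Iio (θ α) ↪o Iio (θ β))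
  theta_lt : ∀ α < ω_ 1, θ α < ω_ 1
  theta_top : θ (ω_ 1) = ω_ 2
  /-- `F α (α + 1)` consists of the identity of `θ α` and the shift of `θ α` at `γ`. -/
  successor : ∀ α < ω_ 1, ∃ γ η : Ordinal.{0}, θ α = γ + η ∧ θ (α + 1) = θ α + η ∧
    ∃ i s : Iio (θ α) ↪o Iio (θ (α + 1)), F α (α + 1) = {i, s} ∧
      (∀ ξ, (i ξ : Ordinal) = ξ) ∧
      (∀ ξ : Iio (θ α), (ξ : Ordinal) < γ → (s ξ : Ordinal) = ξ) ∧
      ∀ ξ < η, ∀ h : γ + ξ < θ α, (s ⟨γ + ξ, h⟩ : Ordinal) = θ α + ξ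
  composition : ∀ α β γ, α < β → β < γ → γ ≤ ω_ 1 →
    F α γ = {k | ∃ f ∈ F α β, ∃ g ∈ F β γ, k = f.trans g}
  factoring : ∀ α γ, α < γ → γ ≤ ω_ 1 → Order.IsSuccLimit γ → ∀ f ∈ F α γ, ∀ g ∈ F α γ,
    ∃ β, α < β ∧ β < γ ∧ ∃ f' ∈ F α β, ∃ g' ∈ F α β, ∃ h ∈ F β γ,
      f = f'.trans h ∧ g = g'.trans h
  fullness : ∀ α β, α < β → β ≤ ω_ 1 → ∀ ξ : Iio (θ β), ∃ f ∈ F α β, ξ ∈ range f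

namespace SimplifiedMorass

variable (M : SimplifiedMorass)

/-- The `α`-th predecessor `π_α^β(ξ)` of `ξ < θ β`: the unique `η < θ α` with `f η = ξ` for some
`f ∈ F α β` (see `existsUnique_pred`). -/
noncomputable def pred (α β ξ : Ordinal.{0}) : Ordinal.{0} :=
  sInf {η | ∃ h : η < M.θ α, ∃ f ∈ M.F α β, (f ⟨η, h⟩ : Ordinal) = ξ}

theorem eq_of_apply_eq (β : Ordinal.{0}) : ∀ α < β, β ≤ ω_ 1 → ∀ f ∈ M.F α β, ∀ g ∈ M.F α β,
    ∀ η η', f η = g η' → η = η' := by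
  induction β using Ordinal.limitRecOn with
  | zero => intro α h; exact absurd h not_lt_zero
  | add_one δ ih =>
    have key : δ + 1 ≤ ω_ 1 → ∀ f ∈ M.F δ (δ + 1), ∀ g ∈ M.F δ (δ + 1),
        ∀ η η', f η = g η' → η = η' := by
      intro hle
      obtain ⟨γ, ε, h1, h2, i, s, h3, h4, h5, h6⟩ :=
        M.successor δ (lt_of_lt_of_le (Order.lt_succ δ) hle)
      have is : ∀ η η', i η = s η' → η = η' := by
        intro η η' h
        have h' : (i η : Ordinal) = s η' := by rw [h]
        rw [h4] at h'
        rcases lt_or_ge (η' : Ordinal) γ with hlt | hge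
        · rw [h5 η' hlt] at h'
          exact Subtype.ext h'
        · have e : γ + ((η' : Ordinal) - γ) = η' := Ordinal.add_sub_cancel_of_le hge
          have hη' : (η' : Ordinal) < M.θ δ := η'.2
          have hlt : (η' : Ordinal) - γ < ε := by
            rw [← add_lt_add_iff_left γ, e, ← h1]
            exact hη'
          have h7 := h6 _ hlt (by rw [e]; exact hη')
          have h8 : (⟨γ + ((η' : Ordinal) - γ), by rw [mem_Iio, e]; exact hη'⟩ : Iio (M.θ δ))
              = η' := Subtype.ext e
          rw [h8] at h7
          rw [h7] at h'
          have : (η : Ordinal) < M.θ δ := η.2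
          rw [h'] at this
          exact absurd this (not_lt.2 le_self_add)
      intro f hf g hg η η' h
      rw [h3] at hf hg
      rcases hf with rfl | rfl <;> rcases hg with rfl | rfl
      · exact RelEmbedding.injective _ h
      · exact is _ _ h
      · exact (is _ _ h.symm).symm
      · exact RelEmbedding.injective _ h
    intro α hα hle f hf g hg η η' h
    rcases (Order.lt_succ_iff.1 hα).eq_or_lt with rfl | hlt
    · exact key hle f hf g hg η η' h
    · have hδ : δ < δ + 1 := Order.lt_succ δ
      have hc := M.composition α δ (δ + 1) hlt hδ hle
      change f ∈ M.F α (δ + 1) at hf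
      change g ∈ M.F α (δ + 1) at hg
      rw [hc] at hf hg
      obtain ⟨f1, hf1, f2, hf2, rfl⟩ := hf
      obtain ⟨g1, hg1, g2, hg2, rfl⟩ := hg
      exact ih α hlt (hδ.le.trans hle) f1 hf1 g1 hg1 _ _ (key hle f2 hf2 g2 hg2 _ _ h)
  | limit γ hγ ih =>
    intro α hα hle f hf g hg η η' h
    obtain ⟨β, h1, h2, f', hf', g', hg', k, hk, rfl, rfl⟩ := M.factoring α γ hα hle hγ f hf g hg
    exact ih β h2 α h1 (h2.le.trans hle) f' hf' g' hg' _ _ (k.injective h)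

theorem existsUnique_pred {α β ξ : Ordinal.{0}} (h : α < β) (hβ : β ≤ ω_ 1) (hξ : ξ < M.θ β) :
    ∃! η, ∃ h : η < M.θ α, ∃ f ∈ M.F α β, (f ⟨η, h⟩ : Ordinal) = ξ := by
  obtain ⟨f, hf, η, hη⟩ := M.fullness α β h hβ ⟨ξ, hξ⟩
  refine ⟨η, ⟨η.2, f, hf, by simp [hη]⟩, ?_⟩
  rintro η' ⟨h', g, hg, e⟩
  have := M.eq_of_apply_eq β α h hβ g hg f hf ⟨η', h'⟩ η (Subtype.ext (by rw [e, hη]))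
  exact congrArg Subtype.val this

/-- The ordering `ξ ≼ η` on `ω₂`. -/
def le (ξ η : Omega2) : Prop :=
  ∀ α < ω_ 1, M.pred α (ω_ 1) ξ ≤ M.pred α (ω_ 1) η

/-- The ordering `ξ ≼_α η` on `ω₂`. -/
def leAt (α : Omega1) (ξ η : Omega2) : Prop :=
  M.le ξ η ∧ M.pred α (ω_ 1) ξ = M.pred α (ω_ 1) η

/-- The morass is stationary: `{f[θ_α] : α < ω₁, f ∈ F_{α,ω₁}}` is stationary in `[ω₂]^ω`. -/
def Stationary : Prop :=
  IsStationaryCtbl {A : Set Omega2 | ∃ α < ω_ 1, ∃ f ∈ M.F α (ω_ 1),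
    A = {ξ | ∃ η, (f η : Ordinal) = ξ}}

/-- The `ℵ₂`-antichain condition: no antichain of size `ℵ₂` in `(ω₂, ≼)^ω`. -/
def AntichainCondition : Prop :=
  ∀ X : Set (ℕ → Omega2), #X = ℵ_ 2 → ∃ s ∈ X, ∃ t ∈ X, s ≠ t ∧ ∀ n, M.le (s n) (t n)

/-- The members of the family `𝓕(M)` of countable partial functions from `ω₂` to `ω₁` whose
domain is `u`. -/
def family (u : Set Omega2) : Set (u → Omega1) :=
  {f | u.Countable ∧
    (∀ ξ η : u, M.leAt (f η) ξ η → f ξ = f η) ∧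
    ∀ α ∈ range f, ∃ ζ : Omega2, ∀ ξ : u, f ξ = α → M.le ξ ζ}

/-- The restriction of a member of `𝓕(M)` to a subset `u` of its domain `v`. -/
def restrict {u v : Set Omega2} (h : u ⊆ v) (f : M.family v) : M.family u :=
  ⟨fun ξ => f.1 (inclusion h ξ), f.2.1.mono h,
    fun ξ η hξη => f.2.2.1 (inclusion h ξ) (inclusion h η) hξη, by
      rintro _ ⟨η, rfl⟩
      obtain ⟨ζ, hζ⟩ := f.2.2.2 _ (mem_range_self (inclusion h η))
      exact ⟨ζ, fun ξ hξ => hζ (inclusion h ξ) hξ⟩⟩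

/-! ### The structure `C` -/

/-- The layer `G_u`: the finite subsets of `𝓕_u`, a Boolean group under symmetric difference. -/
abbrev Layer (u : Set Omega2) : Type 1 := Finset (M.family u)

open Classical in
/-- The homomorphism `π_{u,v} : G_v → G_u` with `π_{u,v} {f} = {f ↾ u}`: a function `g` belongs to
the image of `b` iff it is the restriction of an odd number of members of `b`. -/
noncomputable def proj {u v : Set Omega2} (h : u ⊆ v) (b : M.Layer v) : M.Layer u :=
  (b.image (M.restrict h)).filter fun g => Odd (b.filter fun f => M.restrict h f = g).card

open Classical in
theorem mem_proj {u v : Set Omega2} (h : u ⊆ v) (b : M.Layer v) (g : M.family u) :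
    g ∈ M.proj h b ↔ Odd (b.filter fun f => M.restrict h f = g).card := by
  rw [proj, Finset.mem_filter, and_iff_right_iff_imp]
  intro hodd
  obtain ⟨f, hf⟩ := Finset.card_pos.1 hodd.pos
  rw [Finset.mem_filter] at hf
  exact Finset.mem_image.2 ⟨f, hf⟩

theorem proj_singleton {u v : Set Omega2} (h : u ⊆ v) (f : M.family v) :
    M.proj h {f} = {M.restrict h f} := by
  classical
  ext g
  rw [mem_proj, Finset.filter_singleton, Finset.mem_singleton]
  split_ifs with hg
  · simp [hg]
  · simp [Ne.symm hg]

open Classical in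
theorem proj_symmDiff {u v : Set Omega2} (h : u ⊆ v) (a b : M.Layer v) :
    M.proj h (a ∆ b) = M.proj h a ∆ M.proj h b := by
  have key : ∀ (P : M.family v → Prop) [DecidablePred P], Odd ((a ∆ b).filter P).card ↔
      (Odd (a.filter P).card ∧ ¬ Odd (b.filter P).card) ∨
        (Odd (b.filter P).card ∧ ¬ Odd (a.filter P).card) := by
    intro P _
    have e : (a ∆ b).filter P = (a.filter P \ b.filter P) ∪ (b.filter P \ a.filter P) := by
      ext f
      simp only [Finset.mem_filter, Finset.mem_symmDiff, Finset.mem_union, Finset.mem_sdiff]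
      tauto
    have d : Disjoint (a.filter P \ b.filter P) (b.filter P \ a.filter P) := disjoint_sdiff_sdiff
    have h1 := Finset.card_sdiff_add_card_inter (a.filter P) (b.filter P)
    have h2 := Finset.card_sdiff_add_card_inter (b.filter P) (a.filter P)
    rw [Finset.inter_comm] at h2
    rw [e, Finset.card_union_of_disjoint d]
    simp only [Nat.odd_iff]
    omega
  ext g
  rw [Finset.mem_symmDiff, mem_proj, mem_proj, mem_proj]
  exact key _

/-- The base set of `C`: the disjoint union of `ω₂` and the layers `G_u`, `u ∈ [ω₂]^ω`. The empty
sets of different layers are different elements. -/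
abbrev Carrier : Type 1 := Omega2 ⊕ (Σ u : CtblInf Omega2, M.Layer u.1)

/-- An indexing of each `𝓕_u` by elements of `2^ω`, given by the (injective) map that sends
`f ∈ 𝓕_u` to its index. -/
abbrev Indexing : Type 1 := ∀ u : CtblInf Omega2, M.family u.1 ↪ (ℕ → Bool)

variable {M}

/-- The relation `≤` of `C`: the usual ordering of `ω₂`. -/
def relLe (a b : M.Carrier) : Prop :=
  ∃ α β : Omega2, a = Sum.inl α ∧ b = Sum.inl β ∧ α ≤ β

/-- The relation `E` of `C`: an element `α` of `ω₂` belongs to `u(b)`. -/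
def relE (a b : M.Carrier) : Prop :=
  ∃ (α : Omega2) (u : CtblInf Omega2) (x : M.Layer u.1),
    a = Sum.inl α ∧ b = Sum.inr ⟨u, x⟩ ∧ α ∈ u.1

open Classical in
/-- The relation `R_{n,i}` of `C`: `a` and `b` lie in the same layer `G_u`, their symmetric
difference is a singleton `{f}`, and the `n`-th digit of the index of `f` is `i`. -/
def relR (idx : M.Indexing) (n : ℕ) (i : Bool) (a b : M.Carrier) : Prop :=
  ∃ (u : CtblInf Omega2) (x y : M.Layer u.1) (f : M.family u.1),
    a = Sum.inr ⟨u, x⟩ ∧ b = Sum.inr ⟨u, y⟩ ∧ x ∆ y = {f} ∧ idx u f n = i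

/-- The relation `S` of `C`: `u(a) ⊆ u(b)` and `π_{u(a),u(b)}(b) = a`. -/
def relS (a b : M.Carrier) : Prop :=
  ∃ (u v : CtblInf Omega2) (x : M.Layer u.1) (y : M.Layer v.1) (h : u.1 ⊆ v.1),
    a = Sum.inr ⟨u, x⟩ ∧ b = Sum.inr ⟨v, y⟩ ∧ M.proj h y = x

end SimplifiedMorass

/-- The relation symbols `≤`, `E`, `R_{n,i}` and `S`, all of them binary. -/
inductive RelSymb : ℕ → Type
  | le : RelSymb 2
  | E : RelSymb 2
  | R (n : ℕ) (i : Bool) : RelSymb 2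
  | S : RelSymb 2

/-- The constant symbol `c`. -/
inductive ConstSymb : ℕ → Type
  | c : ConstSymb 0

/-- The vocabulary of `C`, expanded by the constant symbol `c`. -/
def vocabulary : FirstOrder.Language.{0, 0} := ⟨ConstSymb, RelSymb⟩

namespace SimplifiedMorass

variable {M : SimplifiedMorass}

/-- The expansion `(C, d)` of the structure `C` in which the constant symbol `c` is interpreted
as `d`. -/
def Expansion (_idx : M.Indexing) (_d : M.Carrier) : Type 1 := M.Carrier

instance (idx : M.Indexing) (d : M.Carrier) : vocabulary.Structure (Expansion idx d) where
  funMap s _ := match s with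
    | ConstSymb.c => d
  RelMap r x := match r, x with
    | RelSymb.le, x => relLe (M := M) (x 0) (x 1)
    | RelSymb.E, x => relE (M := M) (x 0) (x 1)
    | RelSymb.R n i, x => relR idx n i (x 0) (x 1)
    | RelSymb.S, x => relS (M := M) (x 0) (x 1)

end SimplifiedMorass

/-- The ordinal `ω` as an element of `[ω₂]^ω`. -/
def omegaSet : CtblInf Omega2 :=
  ⟨{ξ | (ξ : Ordinal.{0}) < Ordinal.omega0}, by
    have e : range (fun n : ℕ => (⟨(n : Ordinal.{0}),
        (Ordinal.natCast_lt_omega0 n).trans_le (Ordinal.omega0_le_omega 2)⟩ : Omega2)) =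
        {ξ : Omega2 | (ξ : Ordinal.{0}) < Ordinal.omega0} := by
      ext ξ
      simp only [mem_range, mem_ofPred_eq, Ordinal.lt_omega0, Subtype.ext_iff, eq_comm]
    rw [← e]
    refine ⟨countable_range _, infinite_range_of_injective fun m n h => ?_⟩
    exact Nat.cast_injective (congrArg Subtype.val h)⟩

/-! ### Cardinal arithmetic on `ω₁` and `ω₂` -/

/-! Suppose `I` witnesses partial isomorphism. Its members fix `ω₂` pointwise by induction along
`≤`, hence respect layers by `E`. The relations `R_{n,i}` detect which single function two elements
of a layer differ by, so on each `G_u` a member is translation by the image `h_u` of `∅_u`. By `S`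
the elements `h_u` cohere under projection, and the constant forces `h_ω = {f*}`, so `h_u` is
nonempty whenever `ω ⊆ u`. Viewed as a σ-closed forcing, `I` thus adds a coherent system of nonempty
finite sets of functions in the family; `CoherentSystem` records what is used of it.

Such a system is refuted in three steps. First, sizes `|h_u|` grow with `u` and stabilise, since an
unbounded chain could be absorbed in one finite set (`exists_stable_card`). Second, no colour can be
forced to be used cofinally in `ω₂`: a morass set `f[θ_δ]` closed under a strategy for finding new
points of that colour would contain unboundedly many such points below one approximation, yet
condition (ii) bounds the points of that colour inside the morass set by one of its elements, for
each of finitely many functions (`not_unbounded_colour`).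

Third, for each `ξ < ω₂` fix an approximation that bounds a colour used at `ξ`, and an extension
choosing a large enough layer element. CH leaves only `ℵ₁` codes for these elements, so `ℵ₂` of them
share a code; the antichain condition gives two with pointwise `≼`-comparable enumerations.
Condition (i) then transports the values of the larger to the smaller, and equal cardinalities
exclude cancellation, so the two choices are compatible (`proj_eq_of_code_eq`). A common extension
uses a colour above its bound, a contradiction. -/

theorem mk_Omega1 : #Omega1 = ℵ_ 1 := by
  rw [Cardinal.mk_Iio_ordinal, card_omega, lift_aleph, Ordinal.lift_one]

theorem mk_Omega2 : #Omega2 = ℵ_ 2 := by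
  rw [Cardinal.mk_Iio_ordinal, card_omega, lift_aleph, Ordinal.lift_ofNat]

theorem isRegular_aleph_two : (ℵ_ 2).IsRegular := by
  rw [← one_add_one_eq_two]
  exact isRegular_aleph_add_one 1

theorem aleph_one_lt_aleph_two : ℵ_ 1 < ℵ_ 2 := aleph_lt_aleph.2 one_lt_two

theorem mk_Iio_Omega2_lt (j : Omega2) : #(Iio j) < ℵ_ 2 := by
  have e : #(Iio j) = #(Iio (j : Ordinal.{0})) :=
    Cardinal.mk_congr ⟨fun i => ⟨i.1.1, i.2⟩, fun i => ⟨⟨i.1, lt_trans (mem_Iio.1 i.2) (mem_Iio.1 j.2)⟩, i.2⟩,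
      fun _ => rfl, fun _ => rfl⟩
  have h : (j : Ordinal.{0}).card < ℵ_ 2 := by
    rw [← lt_ord, ord_aleph]
    exact j.2
  rw [e, Cardinal.mk_Iio_ordinal, ← Ordinal.lift_ofNat.{1, 0}, ← lift_aleph]
  exact Cardinal.lift_lt.2 h

/-- Fewer than `ℵ₂` elements of `ω₂` have a strict upper bound. -/
theorem Omega2.exists_bound {ι : Type 1} (hι : #ι < ℵ_ 2) (f : ι → Omega2) :
    ∃ b : Omega2, ∀ i, f i < b := by
  by_contra! h
  -- Without a strict bound the range is cofinal, against the regularity of `ℵ₂`.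
  have hc : IsCofinal (range f) := fun b => by
    obtain ⟨i, hi⟩ := h b
    exact ⟨f i, mem_range_self i, hi⟩
  have h1 := Order.cof_le hc
  rw [Ordinal.cof_Iio, lift_omega, Ordinal.lift_ofNat, isRegular_aleph_two.cof_omega_eq] at h1
  exact absurd (h1.trans mk_range_le) (not_le.2 hι)

/-- A self-map of `ω₂` is dominated along some sequence of length `ω₂`. -/
theorem Omega2.exists_growing (g : Omega2 → Omega2) :
    ∃ e : Omega2 → Omega2, ∀ i j, i < j → g (e i) < e j := by
  have step : ∀ j : Omega2, ∀ r : (i : Omega2) → i < j → Omega2,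
      ∃ b : Omega2, ∀ i (h : i < j), g (r i h) < b := by
    intro j r
    obtain ⟨b, hb⟩ := Omega2.exists_bound (mk_Iio_Omega2_lt j) fun i : Iio j => g (r i.1 i.2)
    exact ⟨b, fun i h => hb ⟨i, h⟩⟩
  choose b hb using step
  -- Well-founded recursion: `e j` strictly bounds all `g (e i)` with `i < j`, of which there are
  -- fewer than `ℵ₂`.
  refine ⟨wellFounded_lt.fix b, fun i j h => ?_⟩
  rw [wellFounded_lt.fix_eq b j]
  exact hb j _ i h

/-- Counts the possible values of `code`: by CH there are at most `𝔠 ^ ℵ₀ = 𝔠 = ℵ₁`, few enough for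
a pigeonhole over `ω₂`. -/
theorem mk_nat_list_le (hCH : Cardinal.continuum.{0} = Cardinal.aleph 1) :
    #(ℕ → List (Omega1 × Omega1)) ≤ ℵ_ 1 := by
  have hCH1 : Cardinal.continuum.{1} = ℵ_ 1 := by
    have := congrArg Cardinal.lift.{1, 0} hCH
    rwa [lift_continuum, lift_aleph, Ordinal.lift_one] at this
  have h1 : #(List (Omega1 × Omega1)) ≤ Cardinal.continuum.{1} := by
    refine (mk_list_le_max _).trans (max_le aleph0_le_continuum ?_)
    rw [mk_prod, Cardinal.lift_id, mk_Omega1, ← hCH1, continuum_mul_self]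
  rw [← hCH1, mk_pi, prod_const, Cardinal.lift_id'.{0, 1}, mk_nat, lift_aleph0]
  exact (Cardinal.power_le_power_right h1).trans continuum_power_aleph0.le

/-! ### Predecessors -/

namespace SimplifiedMorass

variable (M : SimplifiedMorass)

theorem pred_apply {α β : Ordinal.{0}} (h : α < β) (hβ : β ≤ ω_ 1) {f : Iio (M.θ α) ↪o Iio (M.θ β)}
    (hf : f ∈ M.F α β) (η : Iio (M.θ α)) : M.pred α β (f η) = η := by
  have hu := M.existsUnique_pred h hβ (f η).2
  have hmem : ∃ h : (η : Ordinal) < M.θ α, ∃ f' ∈ M.F α β, (f' ⟨η, h⟩ : Ordinal) = f η :=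
    ⟨η.2, f, hf, rfl⟩
  have e : {η' | ∃ h : η' < M.θ α, ∃ f' ∈ M.F α β, (f' ⟨η', h⟩ : Ordinal) = f η} =
      {(η : Ordinal)} := by
    ext η'
    exact ⟨fun h' => hu.unique h' hmem, fun h' => by rw [mem_singleton_iff.1 h']; exact hmem⟩
  rw [pred, e, csInf_singleton]

theorem pred_lt {α : Ordinal.{0}} (h : α < ω_ 1) (ξ : Omega2) : M.pred α (ω_ 1) ξ < M.θ α := by
  have hξ : (ξ : Ordinal) < M.θ (ω_ 1) := by rw [M.theta_top]; exact ξ.2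
  obtain ⟨f, hf, η, hη⟩ := M.fullness α _ h le_rfl ⟨ξ, hξ⟩
  have e : (ξ : Ordinal) = f η := by rw [hη]
  rw [e, M.pred_apply h le_rfl hf]
  exact η.2

/-- The `α`-th predecessor as an element of `ω₁`. -/
noncomputable def predOmega1 (α : Omega1) (ξ : Omega2) : Omega1 :=
  ⟨M.pred α (ω_ 1) ξ, (M.pred_lt α.2 ξ).trans (M.theta_lt α α.2)⟩

/-! ### Projections of layers -/

variable {M}

theorem proj_empty {u v : Set Omega2} (h : u ⊆ v) : M.proj h ∅ = ∅ := by
  simp [proj]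

open Classical in
theorem proj_subset_image {u v : Set Omega2} (h : u ⊆ v) (b : M.Layer v) :
    M.proj h b ⊆ b.image (M.restrict h) := Finset.filter_subset _ _

theorem exists_restrict_eq {u v : Set Omega2} (h : u ⊆ v) {b : M.Layer v} {g : M.family u}
    (hg : g ∈ M.proj h b) : ∃ f ∈ b, M.restrict h f = g := by
  classical
  exact Finset.mem_image.1 (proj_subset_image h b hg)

/-- Restriction may identify functions or cancel them but creates none; hence coherent choices grow
in size with the layer. -/
theorem card_proj_le {u v : Set Omega2} (h : u ⊆ v) (b : M.Layer v) :
    (M.proj h b).card ≤ b.card := by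
  classical
  exact (Finset.card_le_card (proj_subset_image h b)).trans Finset.card_image_le

/-- If restriction maps a subset of `b` onto `a` and `a`, `b` have the same size, then no
cancellation takes place and `b` projects to `a`. -/
theorem proj_eq_of_card_eq {u v : Set Omega2} (h : u ⊆ v) {a : M.Layer u} {b : M.Layer v}
    (hc : a.card = b.card) (ha : ∀ g ∈ a, ∃ f ∈ b, M.restrict h f = g) : M.proj h b = a := by
  classical
  have hs : a ⊆ b.image (M.restrict h) := fun g hg => Finset.mem_image.2 (ha g hg)
  have e : a = b.image (M.restrict h) :=
    Finset.eq_of_subset_of_card_le hs (Finset.card_image_le.trans hc.ge)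
  have hinj : InjOn (M.restrict h) b := Finset.card_image_iff.1 (by rw [← e, hc])
  ext g
  rw [mem_proj, e, Finset.mem_image]
  constructor
  · intro ho
    obtain ⟨f, hf⟩ := Finset.card_pos.1 ho.pos
    exact ⟨f, Finset.mem_filter.1 hf⟩
  · rintro ⟨f, hf, rfl⟩
    -- By injectivity every fibre has exactly one point, so its parity is odd.
    have e1 : (b.filter fun f' => M.restrict h f' = M.restrict h f) = {f} := by
      ext f'
      rw [Finset.mem_filter, Finset.mem_singleton]
      exact ⟨fun h' => hinj h'.1 hf h'.2, fun h' => by rw [h']; exact ⟨hf, rfl⟩⟩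
    rw [e1, Finset.card_singleton]
    exact odd_one

theorem restrict_apply {u v : Set Omega2} (h : u ⊆ v) (f : M.family v) {ξ : Omega2} (hξ : ξ ∈ u) :
    (M.restrict h f).1 ⟨ξ, hξ⟩ = f.1 ⟨ξ, h hξ⟩ := rfl

end SimplifiedMorass

/-! ### Countably infinite sets and clubs of closed sets. -/

/-- The union of countably many countably infinite sets. -/
def CtblInf.iUnion {X : Type*} (u : ℕ → CtblInf X) : CtblInf X :=
  ⟨⋃ n, (u n).1, countable_iUnion fun n => (u n).2.1,
    (u 0).2.2.mono (subset_iUnion (fun n => (u n).1) 0)⟩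

theorem CtblInf.subset_iUnion {X : Type*} (u : ℕ → CtblInf X) (n : ℕ) :
    (u n).1 ⊆ (CtblInf.iUnion u).1 := Set.subset_iUnion (fun n => (u n).1) n

/-- The union of a countably infinite set and a countable set. -/
def CtblInf.union {X : Type*} (u : CtblInf X) (s : Set X) (hs : s.Countable) : CtblInf X :=
  ⟨u.1 ∪ s, u.2.1.union hs, u.2.2.mono subset_union_left⟩

/-- The sets closed under a finitary operation form a closed unbounded set. -/
theorem isClubCtbl_setOf_closed {X : Type*} (G : List X → X) :
    IsClubCtbl {A : Set X | (A.Countable ∧ A.Infinite) ∧ ∀ l : List X, (∀ x ∈ l, x ∈ A) → G l ∈ A} := by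
  have hmono : ∀ s : ℕ → Set X, Monotone s → ∀ l : List X, (∀ x ∈ l, x ∈ ⋃ n, s n) →
      ∃ n, ∀ x ∈ l, x ∈ s n := by
    intro s hs l
    induction l with
    | nil => exact fun _ => ⟨0, by simp⟩
    | cons a l ih =>
      intro h
      obtain ⟨n, hn⟩ := ih fun x hx => h x (List.mem_cons_of_mem _ hx)
      obtain ⟨m, hm⟩ := mem_iUnion.1 (h a List.mem_cons_self)
      refine ⟨max m n, fun x hx => ?_⟩
      rcases List.mem_cons.1 hx with rfl | hx
      · exact hs (le_max_left m n) hm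
      · exact hs (le_max_right m n) (hn x hx)
  refine ⟨fun u hu => hu.1, fun s hs h => ⟨⟨countable_iUnion fun n => (h n).1.1,
    (h 0).1.2.mono (subset_iUnion s 0)⟩, fun l hl => ?_⟩, fun u hu hi => ?_⟩
  · obtain ⟨n, hn⟩ := hmono s hs l hl
    exact mem_iUnion.2 ⟨n, (h n).2 l hn⟩
  -- One step adds the values of `G` on all finite lists from the set, which stays countable; `ω`
  -- steps close it.
  · let next : Set X → Set X := fun A => A ∪ G '' range (List.map ((↑) : A → X))
    let A : ℕ → Set X := fun n => next^[n] u
    have hA : ∀ n, A (n + 1) = next (A n) := fun n => Function.iterate_succ_apply' _ _ _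
    have hs : Monotone A := monotone_nat_of_le_succ fun n => by rw [hA]; exact subset_union_left
    have hc : ∀ n, (A n).Countable := by
      intro n
      induction n with
      | zero => exact hu
      | succ n ih =>
        rw [hA]
        have := ih.to_subtype
        exact ih.union ((countable_range _).image _)
    refine ⟨⋃ n, A n, ⟨⟨countable_iUnion hc, hi.mono (subset_iUnion A 0)⟩, fun l hl => ?_⟩,
      subset_iUnion A 0⟩
    obtain ⟨n, hn⟩ := hmono A hs l hl
    refine mem_iUnion.2 ⟨n + 1, ?_⟩
    rw [hA]
    lift l to List (A n) using hn
    exact Or.inr ⟨_, ⟨l, rfl⟩, rfl⟩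

/-! ### Coherent systems of layer elements and their refutation. -/

namespace SimplifiedMorass

/-- A system of approximations to a coherent choice of elements `h u` of the layers `G_u`. The
relation `Val p u h` says that the approximation `p` determines the element chosen in `G_u` to be
`h`. Countable chains of approximations are bounded, and whether approximations are compatible can
be read off from the elements that they choose. -/
structure CoherentSystem (M : SimplifiedMorass) (P : Type*) [Preorder P] where
  Val : P → ∀ u : CtblInf Omega2, M.Layer u.1 → Prop
  base : CtblInf Omega2
  mono : ∀ {p q u h}, p ≤ q → Val p u h → Val q u h
  coherent : ∀ {p u v h k} (huv : u.1 ⊆ v.1), Val p u h → Val p v k → M.proj huv k = h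
  nonempty : ∀ {p u h}, base.1 ⊆ u.1 → Val p u h → h.Nonempty
  extend : ∀ p u, ∃ q, p ≤ q ∧ ∃ h, Val q u h
  chain : ∀ p : ℕ → P, Monotone p → ∃ q, ∀ n, p n ≤ q
  -- Here `p'` only certifies that `h` is a choice possible above `p`; compatibility is claimed with
  -- `p`, not with `p'`.
  amalgamate : ∀ p, ∃ u₀ : CtblInf Omega2, ∀ v : CtblInf Omega2, u₀.1 ⊆ v.1 →
    ∀ p' h, p ≤ p' → Val p' v h → ∀ q w k (hvw : v.1 ⊆ w.1), Val q w k → M.proj hvw k = h →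
      ∃ r, p ≤ r ∧ q ≤ r

namespace CoherentSystem

variable {M : SimplifiedMorass} {P : Type*} [Preorder P] (S : M.CoherentSystem P)

/-- Some function in an element chosen by `p` maps `ξ` to `α`. -/
def Colours (p : P) (ξ : Omega2) (α : Omega1) : Prop :=
  ∃ u h, S.Val p u h ∧ ∃ f ∈ h, ∃ hξ : ξ ∈ u.1, f.1 ⟨ξ, hξ⟩ = α

variable {S}

theorem Colours.mono {p q : P} (hpq : p ≤ q) {ξ : Omega2} {α : Omega1} (h : S.Colours p ξ α) :
    S.Colours q ξ α := by
  obtain ⟨u, k, hk, h⟩ := h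
  exact ⟨u, k, S.mono hpq hk, h⟩

theorem exists_extension {p : P} {u v : CtblInf Omega2} (huv : u.1 ⊆ v.1) {h : M.Layer u.1}
    {k : M.Layer v.1} (hu : S.Val p u h) (hv : S.Val p v k) {f : M.family u.1} (hf : f ∈ h) :
    ∃ g ∈ k, M.restrict huv g = f := by
  rw [← S.coherent huv hu hv] at hf
  exact exists_restrict_eq huv hf

/-- Some extension chooses an element over `u`, and coherence with `k` leaves only `h`. -/
theorem exists_val_of_proj_eq {p : P} {u v : CtblInf Omega2} (huv : u.1 ⊆ v.1) {h : M.Layer u.1}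
    {k : M.Layer v.1} (hv : S.Val p v k) (e : M.proj huv k = h) : ∃ q, p ≤ q ∧ S.Val q u h := by
  obtain ⟨q, hq, h', hh'⟩ := S.extend p u
  have := S.coherent huv hh' (S.mono hq hv)
  rw [e] at this
  exact ⟨q, hq, this ▸ hh'⟩

/-- The cardinalities of the chosen elements are eventually constant. -/
theorem exists_stable_card [Nonempty P] : ∃ (p : P) (u : CtblInf Omega2) (n : ℕ),
    ∀ q, p ≤ q → ∀ v : CtblInf Omega2, u.1 ⊆ v.1 → ∀ h, S.Val q v h → h.card = n := by
  by_contra! hno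
  let T := {t : P × Σ u : CtblInf Omega2, M.Layer u.1 // S.Val t.1 t.2.1 t.2.2}
  have step : ∀ t : T, ∃ t' : T, t.1.1 ≤ t'.1.1 ∧ t.1.2.1.1 ⊆ t'.1.2.1.1 ∧
      t.1.2.2.card < t'.1.2.2.card := by
    rintro ⟨⟨p, u, h⟩, hp⟩
    obtain ⟨q, hpq, v, huv, k, hk, hne⟩ := hno p u h.card
    refine ⟨⟨⟨q, v, k⟩, hk⟩, hpq, huv, lt_of_le_of_ne ?_ hne.symm⟩
    have := card_proj_le huv k
    rwa [S.coherent huv (S.mono hpq hp) hk] at this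
  choose next h1 h2 h3 using step
  obtain ⟨p₀⟩ := ‹Nonempty P›
  obtain ⟨p, -, h, hp⟩ := S.extend p₀ omegaSet
  let t : ℕ → T := fun n => next^[n] ⟨⟨p, omegaSet, h⟩, hp⟩
  have ht : ∀ n, t (n + 1) = next (t n) := fun n => Function.iterate_succ_apply' _ _ _
  have hcard : ∀ n, n ≤ (t n).1.2.2.card := by
    intro n
    induction n with
    | zero => exact Nat.zero_le _
    | succ n ih =>
      rw [ht]
      exact Nat.succ_le_of_lt (ih.trans_lt (h3 _))
  obtain ⟨q, hq⟩ := S.chain (fun n => (t n).1.1)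
    (monotone_nat_of_le_succ fun n => by rw [ht]; exact h1 _)
  obtain ⟨r, hqr, k, hk⟩ := S.extend q (CtblInf.iUnion fun n => (t n).1.2.1)
  -- The element `k` over the union projects onto every choice in the chain, so its size bounds them
  -- all; stage `k.card + 1` is too large.
  have hle := card_proj_le (CtblInf.subset_iUnion (fun n => (t n).1.2.1) (k.card + 1)) k
  rw [S.coherent _ (S.mono ((hq (k.card + 1)).trans hqr) (t (k.card + 1)).2) hk] at hle
  exact absurd ((hcard (k.card + 1)).trans hle) (by omega)

/-- In a stationary morass no colour class can be forced to be unbounded in `ω₂`. -/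
theorem not_unbounded_colour (hstat : M.Stationary) (p₀ : P) (α : Omega1) :
    ∃ p, p₀ ≤ p ∧ ∃ β : Omega2, ∀ q, p ≤ q → ∀ ξ, β < ξ → ¬ S.Colours q ξ α := by
  by_contra! hno
  have step : ∀ (p : {p : P // p₀ ≤ p}) (β : Omega2), ∃ (q : {p : P // p₀ ≤ p}) (ξ : Omega2),
      p.1 ≤ q.1 ∧ β < ξ ∧ S.Colours q.1 ξ α := by
    rintro ⟨p, hp⟩ β
    obtain ⟨q, hpq, ξ, h⟩ := hno p hp β
    exact ⟨⟨q, hp.trans hpq⟩, ξ, hpq, h⟩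
  choose next x hnext hx hcol using step
  -- The approximation reached when the list is played as lower bounds, its tail first and its head
  -- last.
  let pl : List Omega2 → {p : P // p₀ ≤ p} := List.foldr (fun ξ p => next p ξ) ⟨p₀, le_rfl⟩
  -- The last point found in that run, above the head and coloured `α`. The value at `[]` is an
  -- arbitrary default.
  let G : List Omega2 → Omega2 := fun l => match l with
    | [] => x ⟨p₀, le_rfl⟩ ⟨0, omega_pos 2⟩
    | ξ :: l => x (pl l) ξ
  obtain ⟨A, ⟨δ, hδ, g, hg, hA⟩, ⟨hAc, hAi⟩, hAG⟩ := hstat _ (isClubCtbl_setOf_closed G)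
  have memA : ∀ ξ : Omega2, ξ ∈ A ↔ ∃ η, (g η : Ordinal) = ξ := fun ξ => by
    rw [← Subtype.val_injective.mem_set_image (s := A), hA, mem_ofPred_eq]
  obtain ⟨e, he⟩ := hAc.exists_eq_range hAi.nonempty
  -- The first `n` elements of `A`, latest first: playing all of `A` gives a chain whose witnesses
  -- stay in `A`.
  let l : ℕ → List Omega2 := fun n => Nat.rec [] (fun n l => e n :: l) n
  have hl : ∀ n, ∀ y ∈ l n, y ∈ A := by
    intro n
    induction n with
    | zero => intro y hy; simp [l] at hy
    | succ n ih =>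
      intro y hy
      rcases List.mem_cons.1 hy with rfl | hy
      · rw [he]; exact mem_range_self n
      · exact ih y hy
  have hxA : ∀ n, x (pl (l n)) (e n) ∈ A := fun n => hAG (l (n + 1)) (hl (n + 1))
  obtain ⟨q, hq⟩ := S.chain (fun n => (pl (l n)).1)
    (monotone_nat_of_le_succ fun n => hnext (pl (l n)) (e n))
  have hqcol : ∀ n, S.Colours q (x (pl (l n)) (e n)) α := fun n =>
    (hcol (pl (l n)) (e n)).mono (hq (n + 1))
  choose u h hval f hf hxu hfx using hqcol
  obtain ⟨r, hqr, k, hk⟩ := S.extend q (CtblInf.iUnion u)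
  -- If `ζ` bounds the colour class in `≼`, then inside `A = g[θ_δ]` it is bounded by `g (π_δ ζ)`,
  -- an element of `A`.
  have bound : ∀ f : M.family (CtblInf.iUnion u).1, ∃ m : A, ∀ y (hy : y ∈ (CtblInf.iUnion u).1),
      y ∈ A → f.1 ⟨y, hy⟩ = α → y ≤ m := by
    intro f
    by_cases hα : α ∈ range f.1
    · obtain ⟨ζ, hζ⟩ := f.2.2.2 α hα
      let m := g ⟨M.pred δ (ω_ 1) ζ, M.pred_lt hδ ζ⟩
      refine ⟨⟨⟨m, by rw [← M.theta_top]; exact m.2⟩, (memA _).2 ⟨_, rfl⟩⟩, ?_⟩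
      intro y hy hyA hfy
      obtain ⟨μ, hμ⟩ := (memA y).1 hyA
      have h1 := hζ ⟨y, hy⟩ hfy δ hδ
      change M.pred δ (ω_ 1) (y : Ordinal) ≤ _ at h1
      rw [← hμ, M.pred_apply hδ le_rfl hg] at h1
      change (y : Ordinal) ≤ m
      rw [← hμ]
      exact g.monotone (show μ ≤ ⟨M.pred δ (ω_ 1) ζ, M.pred_lt hδ ζ⟩ from h1)
    · exact ⟨⟨_, hxA 0⟩, fun y hy _ hfy => absurd ⟨_, hfy⟩ hα⟩
  choose m hm using bound
  classical
  have : Nonempty A := ⟨⟨_, hxA 0⟩⟩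
  -- As `k` is finite, one `z = e n` in `A` bounds the `α`-coloured points of `A` for all its
  -- functions; the witness found above `e n` exceeds it.
  obtain ⟨⟨z, hz⟩, hzmax⟩ := (k.image m).exists_le
  obtain ⟨n, rfl⟩ : z ∈ range e := he ▸ hz
  obtain ⟨f', hf', hres⟩ := exists_extension (CtblInf.subset_iUnion u n)
    (S.mono hqr (hval n)) hk (hf n)
  have h1 : f'.1 ⟨_, CtblInf.subset_iUnion u n (hxu n)⟩ = α := by
    rw [← restrict_apply, hres, hfx]
  exact absurd ((hm f' _ _ (hxA n) h1).trans (hzmax _ (Finset.mem_image_of_mem m hf')))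
    (not_le.2 (hx _ _))

open Classical in
/-- The values and predecessors, along the enumeration `s` of `u`, of the functions in `h`. -/
noncomputable def code {u : Set Omega2} (h : M.Layer u) (s : ℕ → Omega2) (hs : ∀ n, s n ∈ u) :
    ℕ → List (Omega1 × Omega1) :=
  fun n => h.toList.map fun f => (f.1 ⟨s n, hs n⟩, M.predOmega1 (f.1 ⟨s n, hs n⟩) (s n))

/-- Chosen elements with the same code and pointwise `≼`-comparable enumerations are compatible:
the larger one determines the smaller one. -/
theorem proj_eq_of_code_eq {u v w : CtblInf Omega2} (hu : u.1 ⊆ w.1) (hv : v.1 ⊆ w.1)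
    {h : M.Layer u.1} {k : M.Layer v.1} {b : M.Layer w.1} {s t : ℕ → Omega2}
    (hs : ∀ n, s n ∈ u.1) (ht : ∀ n, t n ∈ v.1) (hsr : ∀ ξ ∈ u.1, ∃ n, s n = ξ)
    (hcode : code h s hs = code k t ht) (hst : ∀ n, M.le (s n) (t n))
    (hb : M.proj hv b = k) (hcard : h.card = b.card) : M.proj hu b = h := by
  refine proj_eq_of_card_eq hu hcard fun g hg => ?_
  -- Equal codes match the functions of `h` and `k` by their position in the lists.
  obtain ⟨i, hi, rfl⟩ := List.mem_iff_getElem.1 (Finset.mem_toList.2 hg)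
  have hlen : h.toList.length = k.toList.length := by
    have := congrArg List.length (congrFun hcode 0)
    simpa only [code, List.length_map] using this
  have hi' : i < k.toList.length := hlen ▸ hi
  have hk : k.toList[i] ∈ M.proj hv b := by
    rw [hb]
    exact Finset.mem_toList.1 (List.getElem_mem hi')
  obtain ⟨f, hf, hres⟩ := exists_restrict_eq hv hk
  refine ⟨f, hf, Subtype.ext (funext fun ⟨ξ, hξ⟩ => ?_)⟩
  obtain ⟨n, rfl⟩ := hsr ξ hξ
  have hn : (code h s hs n)[i]? = (code k t ht n)[i]? := by rw [hcode]
  simp only [code, List.getElem?_map, List.getElem?_eq_getElem hi,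
    List.getElem?_eq_getElem hi', Option.map_some, Option.some.injEq, Prod.mk.injEq] at hn
  rw [← hres, restrict_apply] at hn
  obtain ⟨hn1, hn2⟩ := hn
  rw [hn1] at hn2
  rw [restrict_apply, hn1]
  -- With `α = f (t n)`, the codes give `π_α (s n) = π_α (t n)`, so `s n ≼_α t n` and condition (i)
  -- yields `f (s n) = α`.
  exact f.2.2.1 ⟨s n, hu hξ⟩ ⟨t n, hv (ht n)⟩ ⟨hst n, congrArg Subtype.val hn2⟩

/-- Under CH, coherent systems do not exist over a stationary morass with the `ℵ₂`-antichain
condition. -/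
theorem isEmpty (hCH : Cardinal.continuum.{0} = Cardinal.aleph 1) (hstat : M.Stationary)
    (hanti : M.AntichainCondition) (S : M.CoherentSystem P) : IsEmpty P := by
  by_contra hP
  rw [not_isEmpty_iff] at hP
  obtain ⟨p₁, u₁, N, hN⟩ := exists_stable_card (S := S)
  have choice : ∀ ξ : Omega2, ∃ (q q' : P) (α : Omega1) (β : Omega2) (u : CtblInf Omega2)
      (h : M.Layer u.1) (s : ℕ → Omega2) (hs : ∀ n, s n ∈ u.1), p₁ ≤ q' ∧ u₁.1 ⊆ u.1 ∧
      (∀ r, q ≤ r → ∀ ξ', β < ξ' → ¬ S.Colours r ξ' α) ∧ S.Val q' u h ∧ q ≤ q' ∧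
      (∀ r w k (huw : u.1 ⊆ w.1), S.Val r w k → M.proj huw k = h → ∃ r', q ≤ r' ∧ r ≤ r') ∧
      s 0 = ξ ∧ (∀ η ∈ u.1, ∃ n, s n = η) ∧ α ∈ (code h s hs 0).map Prod.fst := by
    intro ξ
    let v : CtblInf Omega2 := S.base.union {ξ} (countable_singleton ξ)
    have hξv : ξ ∈ v.1 := Or.inr rfl
    obtain ⟨p, hp, k, hk⟩ := S.extend p₁ v
    obtain ⟨f, hf⟩ := S.nonempty (show S.base.1 ⊆ v.1 from subset_union_left) hk
    obtain ⟨q, hpq, β, hβ⟩ := not_unbounded_colour (S := S) hstat p (f.1 ⟨ξ, hξv⟩)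
    obtain ⟨u₀, hu₀⟩ := S.amalgamate q
    let u : CtblInf Omega2 := (v.union u₁.1 u₁.2.1).union u₀.1 u₀.2.1
    have hvu : v.1 ⊆ u.1 := subset_union_left.trans subset_union_left
    obtain ⟨q', hqq', h, hh⟩ := S.extend q u
    obtain ⟨e, he⟩ := u.2.1.exists_eq_range u.2.2.nonempty
    let s : ℕ → Omega2 := fun n => Nat.casesOn n ξ e
    have hs : ∀ n, s n ∈ u.1 := by
      rintro (_ | n)
      · exact hvu hξv
      · rw [he]; exact mem_range_self n
    refine ⟨q, q', _, β, u, h, s, hs, hp.trans (hpq.trans hqq'),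
      subset_union_right.trans subset_union_left, hβ, hh, hqq',
      fun r w k huw hrw e => hu₀ u subset_union_right q' h hqq' hh r w k huw hrw e, rfl, ?_, ?_⟩
    · intro η hη
      rw [he] at hη
      obtain ⟨n, rfl⟩ := hη
      exact ⟨n + 1, rfl⟩
    · obtain ⟨f', hf', rfl⟩ := exists_extension hvu (S.mono (hpq.trans hqq') hk) hh hf
      refine List.mem_map.2 ⟨_, List.mem_map.2 ⟨f', Finset.mem_toList.2 hf', rfl⟩, rfl⟩
  choose q q' α β u h s hs hp₁ hu₁ hβ hval hqq' hamalg hs0 hsr hα using choice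
  -- Thinning out makes `e` strictly increasing and puts `e j` above the colour bound `β (e i)` for
  -- all `i < j`.
  obtain ⟨e, he⟩ := Omega2.exists_growing fun ξ => max ξ (β ξ)
  have heinj : ∀ i j, i ≠ j → e i ≠ e j := by
    intro i j hij heq
    rcases lt_or_gt_of_ne hij with hlt | hlt
    · exact absurd ((le_max_left _ _).trans_lt (he i j hlt)) (by simp [heq])
    · exact absurd ((le_max_left _ _).trans_lt (he j i hlt)) (by simp [heq])
  obtain ⟨c, hc⟩ := infinite_pigeonhole_card
    (fun i => code (h (e i)) (s (e i)) (hs (e i))) (ℵ_ 2) mk_Omega2.ge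
    isRegular_aleph_two.aleph0_le
    (by rw [isRegular_aleph_two.cof_ord]; exact (mk_nat_list_le hCH).trans_lt aleph_one_lt_aleph_two)
  set Y := (fun i => code (h (e i)) (s (e i)) (hs (e i))) ⁻¹' {c} with hY
  have hsinj : Function.Injective fun i => s (e i) := by
    intro i j hij
    by_contra hne
    have := congrFun hij 0
    simp only [hs0] at this
    exact heinj i j hne this
  have hX : #((fun i => s (e i)) '' Y) = ℵ_ 2 := by
    rw [mk_image_eq hsinj]
    exact le_antisymm ((mk_set_le Y).trans mk_Omega2.le) hc
  obtain ⟨-, ⟨i, hi, rfl⟩, -, ⟨j, hj, rfl⟩, hne, hle⟩ := hanti _ hX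
  have hij : i ≠ j := fun h => hne (by rw [h])
  have hcode : code (h (e i)) (s (e i)) (hs (e i)) = code (h (e j)) (s (e j)) (hs (e j)) :=
    (show _ = c from hi).trans (show _ = c from hj).symm
  let w : CtblInf Omega2 := (u (e i)).union (u (e j)).1 (u (e j)).2.1
  have hiw : (u (e i)).1 ⊆ w.1 := subset_union_left
  have hjw : (u (e j)).1 ⊆ w.1 := subset_union_right
  -- Start from the `≼`-larger side `j`; its choice over `w` also projects to the choice of `i`, so
  -- amalgamation brings in `q (e i)`.
  obtain ⟨r, hr, b, hb⟩ := S.extend (q' (e j)) w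
  have hproj : M.proj hiw b = h (e i) :=
    proj_eq_of_code_eq hiw hjw (hs (e i)) (hs (e j)) (hsr (e i)) hcode hle
      (S.coherent hjw (S.mono hr (hval (e j))) hb)
      ((hN _ (hp₁ (e i)) _ (hu₁ (e i)) _ (hval (e i))).trans
        (hN _ ((hp₁ (e j)).trans hr) _ ((hu₁ (e i)).trans hiw) _ hb).symm)
  obtain ⟨r₁, hir₁, hrr₁⟩ := hamalg (e i) r w b hiw hb hproj
  obtain ⟨r₂, hr₁₂, hvi⟩ := exists_val_of_proj_eq hiw (S.mono hrr₁ hb) hproj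
  have hvj : S.Val r₂ (u (e j)) (h (e j)) := S.mono (hr.trans (hrr₁.trans hr₁₂)) (hval (e j))
  -- The antichain condition does not tell which of `i`, `j` is smaller, so the final contradiction
  -- is stated for both orders. Equal codes make `α (e a)` a colour used at `e b`, above its bound.
  have key : ∀ a b, q (e a) ≤ r₂ → S.Val r₂ (u (e b)) (h (e b)) →
      code (h (e a)) (s (e a)) (hs (e a)) = code (h (e b)) (s (e b)) (hs (e b)) → ¬ a < b := by
    intro a b hqa hvb hab hlt
    refine hβ (e a) r₂ hqa (e b) ((le_max_right _ _).trans_lt (he a b hlt)) ?_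
    have h1 := hα (e a)
    rw [hab] at h1
    obtain ⟨y, h2, h3⟩ := List.mem_map.1 h1
    obtain ⟨f, hf, rfl⟩ := List.mem_map.1 h2
    have h4 : ∀ (ξ : Omega2) (hξ : ξ ∈ (u (e b)).1), s (e b) 0 = ξ → f.1 ⟨ξ, hξ⟩ = α (e a) := by
      rintro _ _ rfl
      exact h3
    have hmem : e b ∈ (u (e b)).1 := by
      have := hs (e b) 0
      rwa [hs0] at this
    exact ⟨_, _, hvb, f, Finset.mem_toList.1 hf, hmem, h4 _ _ (hs0 (e b))⟩
  rcases lt_or_gt_of_ne hij with hlt | hlt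
  · exact key i j (hir₁.trans hr₁₂) hvj hcode hlt
  · exact key j i ((hqq' (e j)).trans (hr.trans (hrr₁.trans hr₁₂))) hvi hcode.symm hlt

end CoherentSystem

end SimplifiedMorass

/-! ### Partial isomorphisms as relations -/

namespace PartialIso

open FirstOrder.Language

universe u v w

variable {L : FirstOrder.Language.{u, v}} {A B : Type w} [L.Structure A] [L.Structure B]

/-- The graph of a partial isomorphism. -/
def Maps (p : A ≃ₚ[L] B) (a : A) (b : B) : Prop :=
  ∃ h : a ∈ p.dom, (p.toEquiv ⟨a, h⟩ : B) = b

theorem exists_maps {p : A ≃ₚ[L] B} {a : A} (h : a ∈ p.dom) : ∃ b, Maps p a b := ⟨_, h, rfl⟩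

theorem exists_maps_of_mem_cod {p : A ≃ₚ[L] B} {b : B} (h : b ∈ p.cod) : ∃ a, Maps p a b :=
  ⟨p.toEquiv.symm ⟨b, h⟩, (p.toEquiv.symm ⟨b, h⟩).2, by simp⟩

theorem Maps.eq {p : A ≃ₚ[L] B} {a : A} {b c : B} (h : Maps p a b) (h' : Maps p a c) : b = c := by
  obtain ⟨_, rfl⟩ := h
  obtain ⟨_, rfl⟩ := h'
  rfl

theorem Maps.mono {p q : A ≃ₚ[L] B} (hpq : p ≤ q) {a : A} {b : B} (h : Maps p a b) :
    Maps q a b := by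
  obtain ⟨ha, rfl⟩ := h
  exact ⟨FirstOrder.Language.PartialEquiv.dom_le_dom hpq ha,
    congrArg Subtype.val (FirstOrder.Language.PartialEquiv.toEquiv_inclusion_apply hpq ⟨a, ha⟩)⟩

theorem le_of_maps {p q : A ≃ₚ[L] B} (h : ∀ a b, Maps p a b → Maps q a b) : p ≤ q := by
  refine FirstOrder.Language.PartialEquiv.le_iff.2
    ⟨fun a ha => (h a _ ⟨ha, rfl⟩).1, fun b hb => ?_, fun ⟨a, ha⟩ => ?_⟩
  · obtain ⟨a, ha⟩ := exists_maps_of_mem_cod hb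
    obtain ⟨ha', rfl⟩ := h a b ha
    exact (q.toEquiv _).2
  · obtain ⟨ha', e⟩ := h a _ ⟨ha, rfl⟩
    exact Subtype.ext e.symm

theorem Maps.rel_iff {p : A ≃ₚ[L] B} {a a' : A} {b b' : B} (h : Maps p a b) (h' : Maps p a' b')
    (r : L.Relations 2) : FirstOrder.Language.Structure.RelMap r ![b, b'] ↔
      FirstOrder.Language.Structure.RelMap r ![a, a'] := by
  obtain ⟨ha, rfl⟩ := h
  obtain ⟨ha', rfl⟩ := h'
  have h1 := p.toEquiv.map_rel r ![⟨a, ha⟩, ⟨a', ha'⟩]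
  have h2 := p.dom.subtype.map_rel r ![⟨a, ha⟩, ⟨a', ha'⟩]
  have h3 := p.cod.subtype.map_rel r (p.toEquiv ∘ ![⟨a, ha⟩, ⟨a', ha'⟩])
  have e2 : p.dom.subtype ∘ ![⟨a, ha⟩, ⟨a', ha'⟩] = ![a, a'] := by
    ext i; fin_cases i <;> rfl
  have e3 : p.cod.subtype ∘ p.toEquiv ∘ ![⟨a, ha⟩, ⟨a', ha'⟩] =
      ![(p.toEquiv ⟨a, ha⟩ : B), (p.toEquiv ⟨a', ha'⟩ : B)] := by
    ext i; fin_cases i <;> rfl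
  rw [e2] at h2
  rw [e3] at h3
  exact h3.trans (h1.trans h2.symm)

theorem maps_const (p : A ≃ₚ[L] B) (c : L.Constants) : Maps p (c : A) (c : B) := by
  have hA : (c : A) ∈ p.dom := p.dom.constants_mem c
  refine ⟨hA, ?_⟩
  have h1 : (⟨(c : A), hA⟩ : p.dom) = (c : p.dom) :=
    Subtype.ext (FirstOrder.Language.HomClass.map_constants p.dom.subtype c).symm
  rw [h1, FirstOrder.Language.HomClass.map_constants]
  exact FirstOrder.Language.HomClass.map_constants p.cod.subtype c

theorem IsBackAndForth.exists_extension {I : Set (A ≃ₚ[L] B)}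
    (hI : IsBackAndForth L A B (ℵ_ 1) I) (p : I) {A₀ : Set A} (hA : A₀.Countable) {B₀ : Set B}
    (hB : B₀.Countable) : ∃ q : I, p ≤ q ∧ A₀ ⊆ q.1.dom ∧ B₀ ⊆ q.1.cod := by
  have hlt : ∀ {X : Type w} {s : Set X}, s.Countable → #s < ℵ_ 1 := fun hs =>
    lt_aleph_one_iff.2 (le_aleph0_iff_set_countable.2 hs)
  obtain ⟨q, hq, h⟩ := hI.2.2 p.1 p.2 A₀ B₀ (hlt hA) (hlt hB)
  exact ⟨⟨q, hq⟩, h⟩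

theorem IsBackAndForth.exists_maps_of_le {I : Set (A ≃ₚ[L] B)}
    (hI : IsBackAndForth L A B (ℵ_ 1) I) (p : I) (a : A) : ∃ q : I, p ≤ q ∧ ∃ b, Maps q.1 a b := by
  obtain ⟨q, hpq, ha, -⟩ := hI.exists_extension p (countable_singleton a) countable_empty
  exact ⟨q, hpq, exists_maps (ha rfl)⟩

theorem IsBackAndForth.exists_maps_of_ge {I : Set (A ≃ₚ[L] B)}
    (hI : IsBackAndForth L A B (ℵ_ 1) I) (p : I) (b : B) : ∃ q : I, p ≤ q ∧ ∃ a, Maps q.1 a b := by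
  obtain ⟨q, hpq, -, hb⟩ := hI.exists_extension p countable_empty (countable_singleton b)
  exact ⟨q, hpq, exists_maps_of_mem_cod (hb rfl)⟩

theorem IsChainClosed.exists_bound {I : Set (A ≃ₚ[L] B)} (hI : IsChainClosed L A B (ℵ_ 1) I)
    (p : ℕ → I) (hp : Monotone p) : ∃ q : I, ∀ n, p n ≤ q := by
  have hex : ∀ i : Iio (Ordinal.omega0.{w}), ∃ n : ℕ, (i : Ordinal) = n := fun i =>
    Ordinal.lt_omega0.1 i.2
  choose n hn using hex
  obtain ⟨q, hq, h⟩ := hI Ordinal.omega0.{w} (omega0_lt_ord.2 aleph0_lt_aleph_one)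
    (fun i => (p (n i)).1) (fun i j hij => hp (by
      have : (i : Ordinal) ≤ j := hij
      rw [hn, hn] at this
      exact_mod_cast this)) (fun i => (p (n i)).2)
  refine ⟨⟨q, hq⟩, fun m => ?_⟩
  have h1 := h ⟨m, Ordinal.natCast_lt_omega0 m⟩
  have h2 : n ⟨m, Ordinal.natCast_lt_omega0 m⟩ = m := by
    exact Nat.cast_injective (hn ⟨m, Ordinal.natCast_lt_omega0 m⟩).symm
  rwa [h2] at h1

end PartialIso

/-! ### Partial isomorphisms between expansions of `C` -/

namespace SimplifiedMorass

open PartialIso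

variable {M : SimplifiedMorass}

theorem relLe_inl {α β : Omega2} :
    relLe (M := M) (Sum.inl α) (Sum.inl β) ↔ α ≤ β :=
  ⟨fun ⟨_, _, h1, h2, h⟩ => by rwa [Sum.inl.inj h1, Sum.inl.inj h2], fun h => ⟨α, β, rfl, rfl, h⟩⟩

theorem relE_inl_inr {α : Omega2} {u : CtblInf Omega2} {x : M.Layer u.1} :
    relE (M := M) (Sum.inl α) (Sum.inr ⟨u, x⟩) ↔ α ∈ u.1 := by
  constructor
  · rintro ⟨_, _, _, h1, h2, h⟩
    cases h1
    cases h2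
    exact h
  · exact fun h => ⟨α, u, x, rfl, rfl, h⟩

open Classical in
theorem relR_inr {idx : M.Indexing} {n : ℕ} {i : Bool} {u : CtblInf Omega2} {x y : M.Layer u.1} :
    relR idx n i (Sum.inr ⟨u, x⟩) (Sum.inr ⟨u, y⟩) ↔ ∃ f, x ∆ y = {f} ∧ idx u f n = i := by
  constructor
  · rintro ⟨_, _, _, f, h1, h2, h⟩
    cases h1
    cases h2
    exact ⟨f, h⟩
  · rintro ⟨f, h⟩
    exact ⟨u, x, y, f, rfl, rfl, h⟩

theorem relS_inr {u v : CtblInf Omega2} {x : M.Layer u.1} {y : M.Layer v.1} :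
    relS (M := M) (Sum.inr ⟨u, x⟩) (Sum.inr ⟨v, y⟩) ↔ ∃ h : u.1 ⊆ v.1, M.proj h y = x := by
  constructor
  · rintro ⟨_, _, _, _, h, h1, h2, h3⟩
    cases h1
    cases h2
    exact ⟨h, h3⟩
  · rintro ⟨h, h3⟩
    exact ⟨u, v, x, y, h, rfl, rfl, h3⟩

variable {idx : M.Indexing} {d d' : M.Carrier}
  {I : Set (Expansion idx d ≃ₚ[vocabulary] Expansion idx d')}

/-- `PartialIso.Maps` for elements of the base set of `C`. -/
def CMaps (p : Expansion idx d ≃ₚ[vocabulary] Expansion idx d') (a b : M.Carrier) : Prop :=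
  Maps p a b

theorem CMaps.mono {p q : Expansion idx d ≃ₚ[vocabulary] Expansion idx d'} (hpq : p ≤ q)
    {a b : M.Carrier} (h : CMaps p a b) : CMaps q a b := Maps.mono hpq h

theorem CMaps.eq {p : Expansion idx d ≃ₚ[vocabulary] Expansion idx d'} {a b c : M.Carrier}
    (h : CMaps p a b) (h' : CMaps p a c) : b = c := Maps.eq (A := Expansion idx d) (B := Expansion idx d') h h'

theorem CMaps.relLe_iff {p : Expansion idx d ≃ₚ[vocabulary] Expansion idx d'} {a a' b b' : M.Carrier}
    (h : CMaps p a b) (h' : CMaps p a' b') : relLe b b' ↔ relLe a a' :=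
  Maps.rel_iff h h' (RelSymb.le : vocabulary.Relations 2)

theorem CMaps.relE_iff {p : Expansion idx d ≃ₚ[vocabulary] Expansion idx d'} {a a' b b' : M.Carrier}
    (h : CMaps p a b) (h' : CMaps p a' b') : relE b b' ↔ relE a a' :=
  Maps.rel_iff h h' (RelSymb.E : vocabulary.Relations 2)

theorem CMaps.relR_iff {p : Expansion idx d ≃ₚ[vocabulary] Expansion idx d'} {a a' b b' : M.Carrier}
    (h : CMaps p a b) (h' : CMaps p a' b') (n : ℕ) (i : Bool) :
    relR idx n i b b' ↔ relR idx n i a a' :=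
  Maps.rel_iff h h' (RelSymb.R n i : vocabulary.Relations 2)

theorem CMaps.relS_iff {p : Expansion idx d ≃ₚ[vocabulary] Expansion idx d'} {a a' b b' : M.Carrier}
    (h : CMaps p a b) (h' : CMaps p a' b') : relS b b' ↔ relS a a' :=
  Maps.rel_iff h h' (RelSymb.S : vocabulary.Relations 2)

theorem cmaps_const (p : Expansion idx d ≃ₚ[vocabulary] Expansion idx d') : CMaps p d d' :=
  maps_const p (ConstSymb.c : vocabulary.Constants)

theorem CMaps.exists_inl_right {p : Expansion idx d ≃ₚ[vocabulary] Expansion idx d'} {ξ : Omega2}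
    {b : M.Carrier} (h : CMaps p (Sum.inl ξ) b) : ∃ η, b = Sum.inl η := by
  obtain ⟨η, -, hη, -⟩ := (h.relLe_iff h).2 (relLe_inl.2 le_rfl)
  exact ⟨η, hη⟩

theorem CMaps.exists_inl_left {p : Expansion idx d ≃ₚ[vocabulary] Expansion idx d'} {η : Omega2}
    {a : M.Carrier} (h : CMaps p a (Sum.inl η)) : ∃ ξ, a = Sum.inl ξ := by
  obtain ⟨ξ, -, hξ, -⟩ := (h.relLe_iff h).1 (relLe_inl.2 le_rfl)
  exact ⟨ξ, hξ⟩

/-- Members of a back-and-forth set are the identity on `ω₂`. -/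
theorem eq_inl_of_cmaps
    (hI : IsBackAndForth vocabulary (Expansion idx d) (Expansion idx d') (ℵ_ 1) I)
    (ξ : Omega2) :
    ∀ (p : I) (b : M.Carrier), CMaps p.1 (Sum.inl ξ) b → b = Sum.inl ξ := by
  induction ξ using WellFoundedLT.induction with
  | _ ξ ih =>
  intro p b hb
  obtain ⟨η, rfl⟩ := hb.exists_inl_right
  rcases lt_trichotomy η ξ with hlt | rfl | hlt
  -- An extension fixes `η` by induction, so `ξ` and `η` share the image `η`, forcing `ξ ≤ η`.
  · obtain ⟨q, hpq, c, hc⟩ := hI.exists_maps_of_le p (Sum.inl η : M.Carrier)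
    obtain rfl := ih η hlt q c hc
    exact absurd (relLe_inl.1 ((CMaps.relLe_iff (CMaps.mono hpq hb) hc).1 (relLe_inl.2 le_rfl)))
      (not_le.2 hlt)
  · rfl
  -- The preimage `ζ` of `ξ` lies at or below `ξ` by order preservation; the induction hypothesis
  -- excludes `ζ < ξ`.
  · obtain ⟨q, hpq, a, ha⟩ := hI.exists_maps_of_ge p (Sum.inl ξ : M.Carrier)
    obtain ⟨ζ, rfl⟩ := CMaps.exists_inl_left ha
    have hb' : CMaps q.1 (Sum.inl ξ) (Sum.inl η) := CMaps.mono hpq hb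
    have hle : ζ ≤ ξ := relLe_inl.1 ((CMaps.relLe_iff ha hb').1 (relLe_inl.2 hlt.le))
    rcases hle.lt_or_eq with h | rfl
    · exact absurd (Sum.inl.inj (ih ζ h q _ ha)) h.ne'
    · exact CMaps.eq hb' ha

/-- Members of a back-and-forth set respect the layers. -/
theorem exists_eq_inr_of_cmaps
    (hI : IsBackAndForth vocabulary (Expansion idx d) (Expansion idx d') (ℵ_ 1) I)
    {p : I} {u : CtblInf Omega2} {x : M.Layer u.1} {b : M.Carrier}
    (hb : CMaps p.1 (Sum.inr ⟨u, x⟩) b) : ∃ y : M.Layer u.1, b = Sum.inr ⟨u, y⟩ := by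
  rcases b with η | ⟨v, y⟩
  · obtain ⟨ξ, hξ⟩ := hb.exists_inl_left
    cases hξ
  · have huv : u = v := by
      refine Subtype.ext (Set.ext fun ξ => ?_)
      obtain ⟨q, hpq, c, hc⟩ := hI.exists_maps_of_le p (Sum.inl ξ : M.Carrier)
      obtain rfl := eq_inl_of_cmaps hI ξ q c hc
      rw [← relE_inl_inr (x := x), ← relE_inl_inr (x := y)]
      exact (CMaps.relE_iff hc (CMaps.mono hpq hb)).symm
    subst huv
    exact ⟨y, rfl⟩

theorem exists_cmaps_inr
    (hI : IsBackAndForth vocabulary (Expansion idx d) (Expansion idx d') (ℵ_ 1) I)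
    (p : I) (u : CtblInf Omega2) (x : M.Layer u.1) :
    ∃ q, p ≤ q ∧ ∃ y : M.Layer u.1, CMaps q.1 (Sum.inr ⟨u, x⟩) (Sum.inr ⟨u, y⟩) := by
  obtain ⟨q, hpq, b, hb⟩ := hI.exists_maps_of_le p (Sum.inr ⟨u, x⟩ : M.Carrier)
  obtain ⟨y, rfl⟩ := exists_eq_inr_of_cmaps hI hb
  exact ⟨q, hpq, y, hb⟩

-- Preservation of all `R_{n,i}` makes `y ∆ y'` a singleton whose index has the same digits as that
-- of `f`; indices are injective.
open Classical in
theorem symmDiff_eq_singleton_of_cmaps {p : Expansion idx d ≃ₚ[vocabulary] Expansion idx d'}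
    {u : CtblInf Omega2} {x x' y y' : M.Layer u.1}
    (h : CMaps p (Sum.inr ⟨u, x⟩) (Sum.inr ⟨u, y⟩))
    (h' : CMaps p (Sum.inr ⟨u, x'⟩) (Sum.inr ⟨u, y'⟩)) {f : M.family u.1} (hf : x ∆ x' = {f}) :
    y ∆ y' = {f} := by
  have key : ∀ n, ∃ g, y ∆ y' = {g} ∧ idx u g n = idx u f n := fun n =>
    relR_inr.1 ((CMaps.relR_iff h h' n (idx u f n)).2 (relR_inr.2 ⟨f, hf, rfl⟩))
  obtain ⟨g, hg, -⟩ := key 0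
  rw [hg]
  congr 1
  refine (idx u).injective (funext fun n => ?_)
  obtain ⟨g', hg', hn⟩ := key n
  rwa [Finset.singleton_injective (hg.symm.trans hg')]

open Classical in
/-- On each layer, members of a back-and-forth set are translations. -/
theorem eq_symmDiff_of_cmaps
    (hI : IsBackAndForth vocabulary (Expansion idx d) (Expansion idx d') (ℵ_ 1) I)
    {u : CtblInf Omega2} (z : M.Layer u.1) :
    ∀ (p : I) (x y y' : M.Layer u.1), CMaps p.1 (Sum.inr ⟨u, x⟩) (Sum.inr ⟨u, y⟩) →
      CMaps p.1 (Sum.inr ⟨u, x ∆ z⟩) (Sum.inr ⟨u, y'⟩) → y' = y ∆ z := by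
  induction z using Finset.induction_on with
  | empty =>
    intro p x y y' h h'
    change CMaps p.1 (Sum.inr ⟨u, x ∆ ⊥⟩) _ at h'
    rw [symmDiff_bot] at h'
    have := CMaps.eq h' h
    cases this
    exact (symmDiff_bot y).symm
  | insert f z hf ih =>
    intro p x y y' h h'
    -- The intermediate `x ∆ z` need not lie in the domain of `p`, hence the passage to an
    -- extension.
    obtain ⟨q, hpq, y'', h''⟩ := exists_cmaps_inr hI p u (x ∆ z)
    obtain rfl := ih q x y y'' (CMaps.mono hpq h) h''
    have e : insert f z = z ∆ {f} := by
      ext g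
      simp only [Finset.mem_insert, Finset.mem_symmDiff, Finset.mem_singleton]
      by_cases hg : g = f
      · subst hg; simp [hf]
      · simp [hg]
    have e1 : (x ∆ z) ∆ (x ∆ insert f z) = {f} := by
      rw [e, ← symmDiff_assoc x, symmDiff_symmDiff_cancel_left]
    have e2 := symmDiff_eq_singleton_of_cmaps h'' (CMaps.mono hpq h') e1
    rw [e, ← symmDiff_assoc, ← e2, symmDiff_symmDiff_cancel_left]

open Classical in
theorem eq_symmDiff_of_cmaps_empty
    (hI : IsBackAndForth vocabulary (Expansion idx d) (Expansion idx d') (ℵ_ 1) I)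
    {u : CtblInf Omega2} {p : I} {x y h : M.Layer u.1}
    (hx : CMaps p.1 (Sum.inr ⟨u, x⟩) (Sum.inr ⟨u, y⟩))
    (h0 : CMaps p.1 (Sum.inr ⟨u, ∅⟩) (Sum.inr ⟨u, h⟩)) : y = h ∆ x := by
  refine eq_symmDiff_of_cmaps hI x p ∅ h y h0 ?_
  change CMaps p.1 (Sum.inr ⟨u, ⊥ ∆ x⟩) _
  rwa [bot_symmDiff]

/-- Empty sets project to empty sets, so they are `S`-related, and their images must be as well. -/
theorem proj_eq_of_cmaps_empty {p : Expansion idx d ≃ₚ[vocabulary] Expansion idx d'}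
    {u v : CtblInf Omega2} (huv : u.1 ⊆ v.1) {h : M.Layer u.1} {k : M.Layer v.1}
    (hu : CMaps p (Sum.inr ⟨u, ∅⟩) (Sum.inr ⟨u, h⟩))
    (hv : CMaps p (Sum.inr ⟨v, ∅⟩) (Sum.inr ⟨v, k⟩)) : M.proj huv k = h :=
  (relS_inr.1 ((CMaps.relS_iff hu hv).2 (relS_inr.2 ⟨huv, proj_empty huv⟩))).2

/-- Over a sufficiently large `v ∈ [ω₂]^ω`, compatibility with `p` only depends on the image of
the empty set of the layer `G_v`. -/
theorem exists_amalgamation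
    (hI : IsBackAndForth vocabulary (Expansion idx d) (Expansion idx d') (ℵ_ 1) I)
    (p : I) : ∃ u₀ : CtblInf Omega2, ∀ v : CtblInf Omega2, u₀.1 ⊆ v.1 →
    ∀ (p' : I) (h : M.Layer v.1), p ≤ p' → CMaps p'.1 (Sum.inr ⟨v, ∅⟩) (Sum.inr ⟨v, h⟩) →
      ∀ (q : I) (w : CtblInf Omega2) (k : M.Layer w.1) (hvw : v.1 ⊆ w.1),
        CMaps q.1 (Sum.inr ⟨w, ∅⟩) (Sum.inr ⟨w, k⟩) → M.proj hvw k = h → ∃ r, p ≤ r ∧ q ≤ r := by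
  have hdom : (p.1.dom : Set (Expansion idx d)).Countable :=
    le_aleph0_iff_set_countable.1 (lt_aleph_one_iff.1 (hI.2.1 p.1 p.2))
  let supp : M.Carrier → Set Omega2 := Sum.elim (fun _ => ∅) fun a => a.1.1
  have hsupp : ∀ a, (supp a).Countable := by
    rintro (ξ | a)
    · exact countable_empty
    · exact a.1.2.1
  let s : Set Omega2 := ⋃ a ∈ (p.1.dom : Set (Expansion idx d)), supp a
  have hs : s.Countable := hdom.biUnion fun a _ => hsupp a
  -- `s` covers all layers met by the domain of `p`; `ω` only ensures that `u₀` is infinite.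
  refine ⟨omegaSet.union s hs, fun v hv p' h hpp' hh q w k hvw hk hkh => ?_⟩
  obtain ⟨r, hqr, hr, -⟩ := hI.exists_extension q
    (hdom.insert (Sum.inr ⟨v, ∅⟩ : M.Carrier)) countable_empty
  refine ⟨r, le_of_maps fun a b hab => ?_, hqr⟩
  obtain ⟨c, hc⟩ := exists_maps (hr (Or.inr hab.1))
  obtain ⟨h', hh'⟩ := exists_maps (hr (Or.inl rfl))
  obtain ⟨h', rfl⟩ := exists_eq_inr_of_cmaps hI hh'
  have ehh' : h' = h :=
    (proj_eq_of_cmaps_empty hvw hh' (CMaps.mono hqr hk)).symm.trans hkh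
  subst ehh'
  suffices e : b = c by rwa [e]
  rcases a with ξ | ⟨z, x⟩
  · exact (eq_inl_of_cmaps hI ξ p b hab).trans (eq_inl_of_cmaps hI ξ r c hc).symm
  · obtain ⟨y, rfl⟩ := exists_eq_inr_of_cmaps hI hab
    obtain ⟨y', rfl⟩ := exists_eq_inr_of_cmaps hI hc
    have hzv : z.1 ⊆ v.1 := fun ξ hξ => hv (Or.inr (mem_biUnion hab.1 hξ))
    obtain ⟨p'', hp'', h1, hh1⟩ := exists_cmaps_inr hI p' z ∅
    obtain ⟨r', hr', h2, hh2⟩ := exists_cmaps_inr hI r z ∅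
    -- Both maps translate `G_z` by the projection of the same `h'`, so they agree at `x`.
    rw [eq_symmDiff_of_cmaps_empty hI (CMaps.mono (hpp'.trans hp'') hab) hh1,
      eq_symmDiff_of_cmaps_empty hI (CMaps.mono hr' hc) hh2,
      ← proj_eq_of_cmaps_empty hzv hh1 (CMaps.mono hp'' hh),
      ← proj_eq_of_cmaps_empty hzv hh2 (CMaps.mono hr' hh')]

/-- A chain closed back-and-forth set between `(C, ∅_ω)` and `(C, {f})` yields a coherent system:
a partial isomorphism chooses the images of the empty sets of the layers. -/
def coherentSystem {f : M.family omegaSet.1}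
    {I : Set (Expansion idx (Sum.inr ⟨omegaSet, ∅⟩) ≃ₚ[vocabulary]
      Expansion idx (Sum.inr ⟨omegaSet, {f}⟩))}
    (hI : IsBackAndForth vocabulary _ _ (ℵ_ 1) I) (hc : IsChainClosed vocabulary _ _ (ℵ_ 1) I) :
    M.CoherentSystem I where
  Val p u h := CMaps p.1 (Sum.inr ⟨u, ∅⟩) (Sum.inr ⟨u, h⟩)
  base := omegaSet
  mono hpq h := CMaps.mono hpq h
  coherent huv hu hv := proj_eq_of_cmaps_empty huv hu hv
  nonempty {p u h} hu hh := by
    rw [Finset.nonempty_iff_ne_empty]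
    rintro rfl
    have := proj_eq_of_cmaps_empty hu (cmaps_const p.1) hh
    rw [proj_empty] at this
    exact absurd this.symm (Finset.singleton_ne_empty f)
  extend p u := exists_cmaps_inr hI p u ∅
  chain p hp := hc.exists_bound p hp
  amalgamate p := exists_amalgamation hI p

end SimplifiedMorass

theorem lemma3p3 (hCH : Cardinal.continuum.{0} = Cardinal.aleph 1)
    (M : SimplifiedMorass) (hstat : M.Stationary) (hanti : M.AntichainCondition)
    (idx : M.Indexing) (fstar : M.family omegaSet.1) :
    ¬ PartialIso.PartiallyIsomorphic vocabulary
      (SimplifiedMorass.Expansion idx (Sum.inr ⟨omegaSet, ∅⟩))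
      (SimplifiedMorass.Expansion idx (Sum.inr ⟨omegaSet, {fstar}⟩))
      (Cardinal.aleph 1) (Cardinal.aleph 1) := by
  rintro ⟨I, hI, hc⟩
  obtain ⟨p, hp⟩ := hI.1
  exact ((SimplifiedMorass.coherentSystem hI hc).isEmpty hCH hstat hanti).false ⟨p, hp⟩
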